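/- **Theorem.** Let $d_1<\dots<d_m$ ($m\ge 1$) be the minimal generators of the semigroup $S=\langle d_1,\dots,d_m\rangle\subseteq\mathbb N$, let $K$ be a field, and let $\beta_{k,j}$ be the graded Betti numbers of the semigroup algebra $K[S]=K[t^s:s\in S]$ regarded, via $x_i\mapsto t^{d_i}$, as a module over $R=K[x_1,\dots,x_m]$ graded by $\deg x_i=d_i$; that is, $F_k=\bigoplus_j R(-j)^{\beta_{k,j}}$ in a minimal graded free resolution $F_\bullet$ of $K[S]$ over $R$. For an integer $q\ge 1$ let $w_q$ be the number of indices $i$ with $q\mid d_i$. Let $q,n$ be integers with $1\le q\le d_m$, $\gcd(n,q)=1$ and $w_q>0$. Then $$\sum_{k=0}^{m-1}\sum_j(-1)^k\beta_{k,j}\,j^r\,e^{i\frac{2\pi n}{q}j}=0\qquad\text{for } r=0,1,\dots,w_q-1,$$ where $0^0=1$, except for $r=m-1$ in the case that $q$ divides all of $d_1,\dots,d_m$. (If $\gcd(d_1,\dots,d_m)=1$, the only excluded pair is $q=1$, $r=m-1$.) -/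

import Mathlib

namespace NumSgp

/-- The submonoid `S = ⟨d₁, …, d_m⟩` of `ℕ` generated by `d₁, …, d_m`. -/
def semigroup {m : ℕ} (d : Fin m → ℕ) : AddSubmonoid ℕ :=
  AddSubmonoid.closure (Set.range d)

/-- `d₁ < ⋯ < d_m` is a minimal system of generators: no generator is a sum (possibly empty, with
repetitions allowed) of the others. In particular all generators are positive. -/
structure IsMinimalBasis {m : ℕ} (d : Fin m → ℕ) : Prop where
  strictMono : StrictMono d
  minimal : ∀ i, d i ∉ AddSubmonoid.closure (d '' {i}ᶜ)

/-- `w_q`, the number of generators divisible by `q`. -/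
def numDivisible {m : ℕ} (d : Fin m → ℕ) (q : ℕ) : ℕ :=
  (Finset.univ.filter fun i => q ∣ d i).card

/-- The semigroup algebra `K[S]`, with basis `t ^ s`, `s ∈ S`. -/
abbrev SemigroupAlgebra (K : Type*) [Field K] {m : ℕ} (d : Fin m → ℕ) :=
  AddMonoidAlgebra K (semigroup d)

/-- The `K`-algebra map `K[x₁, …, x_m] → K[S]`, `x_i ↦ t ^ d_i`, through which `K[S]` is a module
over the polynomial ring. -/
noncomputable def paramHom (K : Type*) [Field K] {m : ℕ} (d : Fin m → ℕ) :
    MvPolynomial (Fin m) K →ₐ[K] SemigroupAlgebra K d :=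
  MvPolynomial.aeval fun i =>
    AddMonoidAlgebra.single
      (⟨d i, AddSubmonoid.subset_closure (Set.mem_range_self i)⟩ : semigroup d) (1 : K)

/-- A minimal graded free resolution
`⋯ → F₂ → F₁ → F₀ → K[S] → 0` of the semigroup algebra over `R = K[x₁, …, x_m]`, graded by
`deg x_i = d_i`. The module `F_k` is `⊕_l R(-deg k l)`, free on a finite basis whose `l`-th element
has degree `deg k l`, and all maps preserve degrees. -/
structure MinimalGradedResolution (K : Type*) [Field K] {m : ℕ} (d : Fin m → ℕ) where
  /-- the rank of `F_k` -/
  rank : ℕ → ℕ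
  /-- the degrees of the basis elements of `F_k` -/
  deg : ∀ k, Fin (rank k) → ℕ
  /-- the differential `F_{k+1} → F_k` -/
  diff : ∀ k, (Fin (rank (k + 1)) → MvPolynomial (Fin m) K) →ₗ[MvPolynomial (Fin m) K]
    (Fin (rank k) → MvPolynomial (Fin m) K)
  /-- the augmentation `F₀ → K[S]`, linear over `R` acting on `K[S]` through `paramHom` -/
  aug : (Fin (rank 0) → MvPolynomial (Fin m) K) →ₛₗ[(paramHom K d).toRingHom]
    SemigroupAlgebra K d
  /-- the augmentation preserves degrees -/
  aug_homogeneous : ∀ l, ∀ s ∈ (aug (Pi.single l 1)).coeff.support, (s : ℕ) = deg 0 l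
  /-- the differentials preserve degrees: the monomial `x ^ e` times the `i`-th basis element
  of `F_k` has degree `∑ e_a d_a + deg k i` -/
  diff_homogeneous : ∀ k l i, ∀ e ∈ (diff k (Pi.single l 1) i).support,
    Finsupp.weight d e + deg k i = deg (k + 1) l
  /-- the complex is a resolution of `K[S]` -/
  aug_surjective : Function.Surjective aug
  exact_aug : Function.Exact (diff 0) aug
  exact_diff : ∀ k, Function.Exact (diff (k + 1)) (diff k)
  /-- minimality: the image of `F_{k+1}` lies in `(x₁, …, x_m) F_k` -/
  minimal : ∀ k l i, MvPolynomial.constantCoeff (diff k (Pi.single l 1) i) = 0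

/-- The graded Betti number `β_{k,j}`: the number of summands `R(-j)` of `F_k`. -/
def MinimalGradedResolution.betti {K : Type*} [Field K] {m : ℕ} {d : Fin m → ℕ}
    (F : MinimalGradedResolution K d) (k j : ℕ) : ℕ :=
  (Finset.univ.filter fun l => F.deg k l = j).card

/-- The finite set of all `j` with `β_{k,j} ≠ 0`. -/
def MinimalGradedResolution.shifts {K : Type*} [Field K] {m : ℕ} {d : Fin m → ℕ}
    (F : MinimalGradedResolution K d) (k : ℕ) : Finset ℕ :=
  Finset.univ.image (F.deg k)

end NumSgp

/-! The sum is the value at ζ = e^{2πin/q} of (z d/dz)^r applied to 𝒦(z) = ∑ (-1)^k β_{k,j} z^j, so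
it suffices that 𝒦 vanishes at ζ to order greater than r. Counting dimensions degree by degree gives
𝒦(z) = H(z) ∏ (1 - z^{d_i}), with H the Hilbert series of K[S]. Since S contains all large multiples
of g = gcd(d_i), H(z)(1 - z^g) is a polynomial; hence ∏ (1 - z^{d_i}) divides 𝒦(z)(1 - z^g)
(`prod_dvd_kPolynomial_mul`). The product vanishes at ζ to order at least w_q, and 1 - z^g has only
simple roots, with ζ among them exactly when q divides every d_i. That case costs one order, whence
the exception (`pow_dvd_kPolynomial`).

Stopping the sum at k = m - 1 requires F_m = 0 (`rank_eq_zero`), which follows from minimality and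
the fact that K[S] is a domain in which the image of each variable is nonzero. -/

namespace NumSgp

/-! ### Length of the resolution -/

section ExactMod

variable {R : Type*} [CommRing R]

/-- If `A → B → C` is exact at `B` modulo `I`, and the division by `x` of relations in `C` modulo
`I` lands in the image of `B`, then it is exact at `B` modulo `I + (x)`. -/
lemma exists_sub_mem_sup_span_singleton {a b c : ℕ} (f : (Fin a → R) →ₗ[R] (Fin b → R))
    (g : (Fin b → R) →ₗ[R] (Fin c → R)) (I : Ideal R) (x : R)
    (hfg : ∀ v, (∀ i, g v i ∈ I) → ∃ w, ∀ i, v i - f w i ∈ I)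
    (hx : ∀ v (u : Fin c → R), (∀ i, g v i - x * u i ∈ I) → ∃ w, ∀ i, u i - g w i ∈ I)
    (v : Fin b → R) (hv : ∀ i, g v i ∈ I ⊔ Ideal.span {x}) :
    ∃ w, ∀ i, v i - f w i ∈ I ⊔ Ideal.span {x} := by
  have h1 : ∀ i, ∃ r, g v i - x * r ∈ I := fun i => by
    obtain ⟨y, hy, z, hz, h⟩ := Submodule.mem_sup.1 (hv i)
    obtain ⟨r, rfl⟩ := Ideal.mem_span_singleton'.1 hz
    exact ⟨r, by rw [← h]; convert hy using 1; ring⟩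
  choose u hu using h1
  -- As u ≡ g w, the corrected element v - x w is a cycle modulo I.
  obtain ⟨w, hw⟩ := hx v u hu
  obtain ⟨z, hz⟩ := hfg (v - x • w) fun i => by
    have := I.add_mem (hu i) (I.mul_mem_left x (hw i))
    simp only [map_sub, map_smul, Pi.sub_apply, Pi.smul_apply, smul_eq_mul]
    convert this using 1; ring
  refine ⟨z, fun i => ?_⟩
  have h2 := Submodule.add_mem_sup (hz i)
    (Ideal.mem_span_singleton'.2 ⟨w i, rfl⟩ : w i * x ∈ Ideal.span {x})
  convert h2 using 1
  simp only [Pi.sub_apply, Pi.smul_apply, smul_eq_mul]; ring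

lemma map_apply_eq_sum {a b : ℕ} (f : (Fin a → R) →ₗ[R] (Fin b → R)) (v : Fin a → R)
    (i : Fin b) : f v i = ∑ l, v l * f (Pi.single l 1) i := by
  conv_lhs => rw [pi_eq_sum_univ' v, map_sum, Finset.sum_apply]
  refine Finset.sum_congr rfl fun l _ => ?_
  rw [map_smul, Pi.smul_apply, smul_eq_mul]

lemma map_apply_mem {a b : ℕ} (f : (Fin a → R) →ₗ[R] (Fin b → R)) (I : Ideal R)
    {v : Fin a → R} (hv : ∀ i, v i ∈ I) (i : Fin b) : f v i ∈ I := by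
  rw [map_apply_eq_sum]
  exact I.sum_mem fun l _ => I.mul_mem_right _ (hv l)

end ExactMod

/-- A variable is a nonzerodivisor modulo other variables. -/
lemma mem_span_X_image_of_X_mul_mem {K σ : Type*} [Field K] {s : Set σ} {a : σ} (ha : a ∉ s)
    {f : MvPolynomial σ K}
    (hf : MvPolynomial.X a * f ∈ Ideal.span (MvPolynomial.X '' s : Set (MvPolynomial σ K))) :
    f ∈ Ideal.span (MvPolynomial.X '' s : Set (MvPolynomial σ K)) := by
  classical
  rw [MvPolynomial.mem_ideal_span_X_image] at hf ⊢
  intro e he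
  obtain ⟨i, hi, h⟩ := hf (Finsupp.single a 1 + e) (by
    rw [MvPolynomial.mem_support_iff, MvPolynomial.coeff_X_mul]
    exact MvPolynomial.mem_support_iff.1 he)
  refine ⟨i, hi, ?_⟩
  have : a ≠ i := fun h => ha (h ▸ hi)
  simpa [Finsupp.single_apply, this] using h

namespace MinimalGradedResolution

variable {K : Type*} [Field K] {m : ℕ} {d : Fin m → ℕ} (F : MinimalGradedResolution K d)

lemma aug_smul (p : MvPolynomial (Fin m) K) (v : Fin (F.rank 0) → MvPolynomial (Fin m) K) :
    F.aug (p • v) = paramHom K d p * F.aug v :=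
  F.aug.map_smulₛₗ p v

/-- The ideal generated by the first `t` variables. -/
noncomputable def varIdeal (K : Type*) [Field K] (m t : ℕ) : Ideal (MvPolynomial (Fin m) K) :=
  Ideal.span (MvPolynomial.X '' {i : Fin m | (i : ℕ) < t})

lemma varIdeal_succ (t : Fin m) :
    varIdeal K m (t + 1) = varIdeal K m t ⊔ Ideal.span {MvPolynomial.X t} := by
  rw [varIdeal, varIdeal, ← Ideal.span_union, ← Set.image_singleton, ← Set.image_union]
  congr 2
  ext i
  simp only [Set.mem_ofPred_eq, Set.mem_union, Set.mem_singleton_iff, Fin.ext_iff]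
  omega

lemma mem_varIdeal_iff (hm : 0 < m) {f : MvPolynomial (Fin m) K} :
    f ∈ varIdeal K m (m - 1 + 1) ↔ MvPolynomial.constantCoeff f = 0 := by
  rw [varIdeal, MvPolynomial.mem_ideal_span_X_image, MvPolynomial.constantCoeff_eq]
  constructor
  · intro h
    by_contra h0
    obtain ⟨i, -, hi⟩ := h 0 (MvPolynomial.mem_support_iff.2 h0)
    exact hi rfl
  · intro h e he
    by_contra! hc
    have : e = 0 := Finsupp.ext fun i => hc i (by have := i.2; simp only [Set.mem_ofPred_eq]; omega)
    exact MvPolynomial.mem_support_iff.1 he (this ▸ h)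

lemma eq_zero_of_X_mul_eq_zero (i : Fin m) {a : SemigroupAlgebra K d}
    (h : paramHom K d (MvPolynomial.X i) * a = 0) : a = 0 := by
  refine (mul_eq_zero.1 h).resolve_left ?_
  simp [paramHom]

/-- This is Tor_{k+1}(K[S], R/(x_0, …, x_t)) = 0 for k ≥ t, by induction on t. Regularity of the
variables on R alone would give it for k > t; the extra index comes from x_0 being a nonzerodivisor
on K[S]. -/
lemma exact_mod_varIdeal (t : ℕ) (ht : t < m) (k : ℕ) (hk : t ≤ k)
    (v : Fin (F.rank (k + 1)) → MvPolynomial (Fin m) K)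
    (hv : ∀ i, F.diff k v i ∈ varIdeal K m (t + 1)) :
    ∃ w, ∀ i, v i - F.diff (k + 1) w i ∈ varIdeal K m (t + 1) := by
  have hex : ∀ k (v : Fin (F.rank (k + 1)) → MvPolynomial (Fin m) K),
      (∀ i, F.diff k v i ∈ varIdeal K m 0) →
      ∃ w, ∀ i, v i - F.diff (k + 1) w i ∈ varIdeal K m 0 := by
    intro k v hv
    have h0 : varIdeal K m 0 = ⊥ := by simp [varIdeal]
    obtain ⟨w, rfl⟩ := (F.exact_diff k v).1 (funext fun i => by simpa [h0] using hv i)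
    exact ⟨w, by simp⟩
  have step : ∀ t : Fin m, ∀ k,
      (∀ v, (∀ i, F.diff k v i ∈ varIdeal K m t) →
        ∃ w, ∀ i, v i - F.diff (k + 1) w i ∈ varIdeal K m t) →
      (∀ v, (∀ i, F.diff (k + 1) v i ∈ varIdeal K m t) →
        ∃ w, ∀ i, v i - F.diff (k + 2) w i ∈ varIdeal K m t) →
      (∀ v, (∀ i, F.diff (k + 1) v i ∈ varIdeal K m (t + 1)) →
        ∃ w, ∀ i, v i - F.diff (k + 2) w i ∈ varIdeal K m (t + 1)) := by
    intro t k h1 h2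
    rw [varIdeal_succ]
    refine exists_sub_mem_sup_span_singleton _ _ _ _ h2 fun v u huv => h1 u fun i => ?_
    -- Applying the differential to d v ≡ x_t u gives x_t · d u ≡ 0, and x_t cancels modulo the
    -- earlier variables.
    refine mem_span_X_image_of_X_mul_mem (a := t) (by simp) ?_
    have := map_apply_mem (F.diff k) (varIdeal K m t)
      (v := F.diff (k + 1) v - (MvPolynomial.X t : MvPolynomial (Fin m) K) • u) huv i
    rw [map_sub, (F.exact_diff k).apply_apply_eq_zero, zero_sub, map_smul] at this
    exact neg_mem_iff.1 this
  induction t generalizing k with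
  | zero =>
    cases k with
    | succ k => exact step ⟨0, ht⟩ k (hex k) (hex (k + 1)) v hv
    | zero =>
      have hs := varIdeal_succ (K := K) ⟨0, ht⟩
      rw [hs] at hv ⊢
      refine exists_sub_mem_sup_span_singleton _ _ _ _ (hex 0) (fun v u huv => ?_) v hv
      have h0 : varIdeal K m 0 = ⊥ := by simp [varIdeal]
      have huv' : F.diff 0 v = (MvPolynomial.X ⟨0, ht⟩ : MvPolynomial (Fin m) K) • u := by
        ext1 i
        simpa [h0, sub_eq_zero] using huv i
      -- Below F_1 the augmentation takes over: x_0 u is a boundary, so x_0 kills the image of u in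
      -- the domain K[S].
      have h1 := F.exact_aug.apply_apply_eq_zero v
      rw [huv', aug_smul] at h1
      obtain ⟨w, rfl⟩ := (F.exact_aug u).1 (eq_zero_of_X_mul_eq_zero _ h1)
      exact ⟨w, by simp⟩
  | succ t ih =>
    obtain ⟨k, rfl⟩ : ∃ k', k = k' + 1 := ⟨k - 1, by omega⟩
    exact step ⟨t + 1, ht⟩ k (ih (by omega) k (by omega)) (ih (by omega) (k + 1) (by omega)) v hv

/-- Since `K[S]` has positive depth, its minimal resolution has length less than `m`. -/
theorem rank_eq_zero (hm : 0 < m) {k : ℕ} (hk : m ≤ k) : F.rank k = 0 := by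
  obtain ⟨k, rfl⟩ : ∃ k', k = k' + 1 := ⟨k - 1, by omega⟩
  by_contra h
  let l : Fin (F.rank (k + 1)) := ⟨0, Nat.pos_of_ne_zero h⟩
  have hd0 : ∀ k v i, MvPolynomial.constantCoeff (F.diff k v i) = 0 := by
    intro k v i
    rw [map_apply_eq_sum, map_sum]
    exact Finset.sum_eq_zero fun l _ => by rw [map_mul, F.minimal, mul_zero]
  -- Modulo all variables the differentials vanish, so exactness would put a basis vector in (x_1,
  -- …, x_m) F_{k+1}.
  obtain ⟨w, hw⟩ := F.exact_mod_varIdeal (m - 1) (by omega) k (by omega) (Pi.single l 1)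
    fun i => (mem_varIdeal_iff hm).2 (hd0 _ _ _)
  have := hw l
  rw [mem_varIdeal_iff hm, map_sub, hd0] at this
  simp at this

end MinimalGradedResolution

/-! ### Dimension counts in graded pieces -/

open Module

section GradedPiece

variable {K A B C α β γ : Type*} [Field K] [AddCommGroup A] [Module K A] [AddCommGroup B]
  [Module K B] [AddCommGroup C] [Module K C]

/-- The piece of degree `j` of a vector space with a basis whose elements carry degrees. -/
def gradedPiece (b : Basis α K A) (δ : α → ℕ) (j : ℕ) : Submodule K A :=
  Submodule.span K (b '' {a | δ a = j})

lemma mem_gradedPiece {b : Basis α K A} {δ : α → ℕ} {j : ℕ} {x : A} :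
    x ∈ gradedPiece b δ j ↔ ∀ a, b.repr x a ≠ 0 → δ a = j := by
  rw [gradedPiece, b.mem_span_image]
  simp [Set.subset_def]

lemma finrank_gradedPiece (b : Basis α K A) (δ : α → ℕ) (j : ℕ) (h : {a | δ a = j}.Finite) :
    finrank K (gradedPiece b δ j) = {a | δ a = j}.ncard := by
  have := (h.image b).fintype
  rw [gradedPiece, finrank_span_set_eq_card (b.linearIndepOn _).id_image, Set.toFinset_card,
    Fintype.card_eq_nat_card, Nat.card_coe_set_eq, Set.ncard_image_of_injective _ b.injective]

lemma finiteDimensional_gradedPiece (b : Basis α K A) (δ : α → ℕ) (j : ℕ)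
    (h : {a | δ a = j}.Finite) : FiniteDimensional K (gradedPiece b δ j) :=
  FiniteDimensional.span_of_finite K (h.image b)

/-- The projection onto the piece of degree `j`. -/
noncomputable def gradedProj (b : Basis α K A) (δ : α → ℕ) (j : ℕ) : A →ₗ[K] A :=
  b.constr K fun a => if δ a = j then b a else 0

lemma gradedProj_basis (b : Basis α K A) (δ : α → ℕ) (j : ℕ) (a : α) :
    gradedProj b δ j (b a) = if δ a = j then b a else 0 := by
  rw [gradedProj, Basis.constr_basis]

lemma gradedProj_mem (b : Basis α K A) (δ : α → ℕ) (j : ℕ) (x : A) :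
    gradedProj b δ j x ∈ gradedPiece b δ j := by
  rw [gradedProj, Basis.constr_apply]
  refine Submodule.sum_mem _ fun a _ => Submodule.smul_mem _ _ ?_
  split_ifs with h
  · exact Submodule.subset_span ⟨a, h, rfl⟩
  · exact zero_mem _

lemma gradedProj_of_mem {b : Basis α K A} {δ : α → ℕ} {i j : ℕ} {x : A}
    (hx : x ∈ gradedPiece b δ i) : gradedProj b δ j x = if i = j then x else 0 := by
  induction hx using Submodule.span_induction with
  | mem x hx =>
    obtain ⟨a, rfl, rfl⟩ := hx
    exact gradedProj_basis ..
  | zero => simp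
  | add x y _ _ hx hy => rw [map_add, hx, hy]; split_ifs <;> simp
  | smul c x _ hx => rw [map_smul, hx]; split_ifs <;> simp

variable {bA : Basis α K A} {bB : Basis β K B} {bC : Basis γ K C} {δA : α → ℕ} {δB : β → ℕ}
  {δC : γ → ℕ} {f : A →ₗ[K] B} {g : B →ₗ[K] C}

lemma gradedProj_map (hf : ∀ a, f (bA a) ∈ gradedPiece bB δB (δA a)) (j : ℕ) (x : A) :
    gradedProj bB δB j (f x) = f (gradedProj bA δA j x) := by
  have : gradedProj bB δB j ∘ₗ f = f ∘ₗ gradedProj bA δA j := bA.ext fun a => by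
    rw [LinearMap.comp_apply, LinearMap.comp_apply, gradedProj_of_mem (hf a), gradedProj_basis]
    split_ifs <;> simp
  exact LinearMap.congr_fun this x

lemma map_gradedPiece_le (hf : ∀ a, f (bA a) ∈ gradedPiece bB δB (δA a)) (j : ℕ) :
    (gradedPiece bA δA j).map f ≤ gradedPiece bB δB j := by
  rw [gradedPiece, Submodule.map_span_le]
  rintro _ ⟨a, rfl, rfl⟩
  exact hf a

/-- A preimage of a homogeneous element can be replaced by its degree j component, so exactness
restricts to each degree. -/
lemma map_gradedPiece (hf : ∀ a, f (bA a) ∈ gradedPiece bB δB (δA a)) (j : ℕ) :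
    (gradedPiece bA δA j).map f = gradedPiece bB δB j ⊓ LinearMap.range f := by
  refine le_antisymm (le_inf (map_gradedPiece_le hf j) (LinearMap.map_le_range)) ?_
  rintro _ ⟨h1, x, rfl⟩
  exact ⟨gradedProj bA δA j x, gradedProj_mem bA δA j x, by
    rw [← gradedProj_map hf, gradedProj_of_mem h1, if_pos rfl]⟩

/-- The dimension count in degree `j` for an exact sequence `A → B → C` of graded maps. -/
theorem finrank_map_add_finrank_map (hf : ∀ a, f (bA a) ∈ gradedPiece bB δB (δA a))
    (hfg : Function.Exact f g) (j : ℕ) (h : {b | δB b = j}.Finite) :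
    finrank K ((gradedPiece bB δB j).map g) + finrank K ((gradedPiece bA δA j).map f) =
      {b | δB b = j}.ncard := by
  have := finiteDimensional_gradedPiece bB δB j h
  rw [← finrank_gradedPiece bB δB j h,
    ← LinearMap.finrank_range_add_finrank_ker (g.domRestrict (gradedPiece bB δB j)),
    LinearMap.range_domRestrict,
    ← (Submodule.comapSubtypeEquivOfLe (map_gradedPiece_le hf j)).finrank_eq]
  suffices h : LinearMap.ker (g.domRestrict (gradedPiece bB δB j)) =
      ((gradedPiece bA δA j).map f).comap (gradedPiece bB δB j).subtype by rw [h]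
  rw [map_gradedPiece hf, ← LinearMap.exact_iff.1 hfg]
  ext x
  simp

end GradedPiece

/-! ### Hilbert series of R and the K-polynomial -/

section SeriesCount

/-- The number of monomials of weighted degree `j`. -/
noncomputable def monomialCount {m : ℕ} (d : Fin m → ℕ) (j : ℕ) : ℕ :=
  {e : Fin m →₀ ℕ | Finsupp.weight d e = j}.ncard

open PowerSeries in
lemma mk_dvd_mul (c : ℕ) (hc : c ≠ 0) :
    (PowerSeries.mk fun n => if c ∣ n then (1 : ℂ) else 0) * (1 - X ^ c) = 1 := by
  ext n
  rw [mul_sub, mul_one, map_sub, coeff_mul_X_pow', coeff_mk, coeff_one]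
  by_cases h : c ≤ n
  · have hn : n ≠ 0 := by omega
    simp [h, hn, Nat.dvd_sub_iff_left h dvd_rfl]
  · rw [if_neg h, sub_zero]
    by_cases hn : n = 0
    · simp [hn]
    · rw [if_neg hn, if_neg fun h' => h (Nat.le_of_dvd (Nat.pos_of_ne_zero hn) h')]

lemma mk_monomialCount {m : ℕ} {d : Fin m → ℕ} (hd : ∀ i, d i ≠ 0) :
    (PowerSeries.mk fun n => (monomialCount d n : ℂ)) =
      ∏ i, PowerSeries.mk fun n => if d i ∣ n then (1 : ℂ) else 0 := by
  classical
  ext n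
  rw [PowerSeries.coeff_mk, PowerSeries.coeff_prod]
  simp only [PowerSeries.coeff_mk, Finset.prod_ite_zero, Finset.prod_const_one]
  rw [Finset.sum_boole, monomialCount, ← Set.ncard_coe_finset]
  congr 1
  -- Exponent vectors e correspond to the decompositions of n into parts d_i e_i.
  refine Set.ncard_congr (fun e _ => Finsupp.equivFunOnFinite.symm fun i => d i * e i) ?_ ?_ ?_
  · rintro e rfl
    simp [Finsupp.weight_apply, Finsupp.sum_fintype, mul_comm]
  · intro e e' _ _ h
    ext i
    have := DFunLike.congr_fun h i
    simpa [hd i] using this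
  · intro l hl
    simp only [Finset.coe_filter, Finset.mem_finsuppAntidiag, Finset.mem_univ, true_imp_iff,
      Set.mem_ofPred_eq, Finset.subset_univ, and_true] at hl
    have hl' : ∀ i, d i * (l i / d i) = l i := fun i => Nat.mul_div_cancel' (hl.2 i)
    refine ⟨Finsupp.equivFunOnFinite.symm fun i => l i / d i, ?_, ?_⟩
    · rw [Set.mem_ofPred_eq, Finsupp.weight_apply, Finsupp.sum_fintype _ _ (by simp), ← hl.1]
      exact Finset.sum_congr rfl fun i _ => by simp [mul_comm, hl']
    · ext i
      simp [hl']

lemma mk_monomialCount_mul {m : ℕ} {d : Fin m → ℕ} (hd : ∀ i, d i ≠ 0) :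
    (PowerSeries.mk fun n => (monomialCount d n : ℂ)) *
      ∏ i, (1 - PowerSeries.X ^ d i) = 1 := by
  rw [mk_monomialCount hd, ← Finset.prod_mul_distrib]
  exact Finset.prod_eq_one fun i _ => mk_dvd_mul _ (hd i)

end SeriesCount

lemma IsMinimalBasis.ne_zero {m : ℕ} {d : Fin m → ℕ} (hd : IsMinimalBasis d) (i : Fin m) :
    d i ≠ 0 := fun h => hd.minimal i (h ▸ zero_mem _)

lemma paramHom_monomial (K : Type*) [Field K] {m : ℕ} (d : Fin m → ℕ) (e : Fin m →₀ ℕ) :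
    ∃ s : semigroup d, (s : ℕ) = Finsupp.weight d e ∧
      paramHom K d (MvPolynomial.monomial e 1) = AddMonoidAlgebra.single s 1 := by
  induction e using Finsupp.induction_linear with
  | zero => exact ⟨0, by simp, by rw [MvPolynomial.monomial_zero']; simp; rfl⟩
  | add e e' h h' =>
    obtain ⟨s, hs, h⟩ := h
    obtain ⟨s', hs', h'⟩ := h'
    refine ⟨s + s', by simp [hs, hs'], ?_⟩
    rw [← one_mul (1 : K), ← MvPolynomial.monomial_mul, map_mul, h, h',
      AddMonoidAlgebra.single_mul_single]
  | single i n =>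
    refine ⟨n • ⟨d i, AddSubmonoid.subset_closure (Set.mem_range_self i)⟩, by
      simp [Finsupp.weight_single], ?_⟩
    rw [← MvPolynomial.X_pow_eq_monomial, map_pow, paramHom, MvPolynomial.aeval_X,
      AddMonoidAlgebra.single_pow, one_pow]

namespace MinimalGradedResolution

variable {K : Type*} [Field K] {m : ℕ} {d : Fin m → ℕ} (F : MinimalGradedResolution K d)

/-- The monomial `K`-basis of `F_k`. -/
noncomputable def monomialBasis (k : ℕ) :
    Basis (Σ _ : Fin (F.rank k), Fin m →₀ ℕ) K (Fin (F.rank k) → MvPolynomial (Fin m) K) :=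
  Pi.basis fun _ => MvPolynomial.basisMonomials (Fin m) K

/-- The degree of an element of the monomial basis of `F_k`. -/
noncomputable def monomialDeg (k : ℕ) (p : Σ _ : Fin (F.rank k), Fin m →₀ ℕ) : ℕ :=
  Finsupp.weight d p.2 + F.deg k p.1

lemma monomialBasis_apply (k : ℕ) (p : Σ _ : Fin (F.rank k), Fin m →₀ ℕ) :
    F.monomialBasis k p = MvPolynomial.monomial p.2 (1 : K) • Pi.single p.1 1 := by
  rw [monomialBasis, Pi.basis_apply, MvPolynomial.coe_basisMonomials, ← Pi.single_smul,
    smul_eq_mul, mul_one]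

/-- The differential as a `K`-linear map. -/
noncomputable def diffK (k : ℕ) : (Fin (F.rank (k + 1)) → MvPolynomial (Fin m) K) →ₗ[K]
    (Fin (F.rank k) → MvPolynomial (Fin m) K) :=
  (F.diff k).restrictScalars K

/-- The augmentation as a `K`-linear map. -/
noncomputable def augK : (Fin (F.rank 0) → MvPolynomial (Fin m) K) →ₗ[K]
    SemigroupAlgebra K d where
  toFun := F.aug
  map_add' := map_add F.aug
  map_smul' c v := by
    rw [← algebraMap_smul (MvPolynomial (Fin m) K) c v, aug_smul, AlgHom.commutes, RingHom.id_apply, Algebra.smul_def]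

lemma diffK_mem (k : ℕ) (p : Σ _ : Fin (F.rank (k + 1)), Fin m →₀ ℕ) :
    F.diffK k (F.monomialBasis (k + 1) p) ∈
      gradedPiece (F.monomialBasis k) (F.monomialDeg k) (F.monomialDeg (k + 1) p) := by
  rw [mem_gradedPiece]
  rintro ⟨i, e⟩ h
  rw [monomialBasis_apply, diffK, LinearMap.restrictScalars_apply, map_smul, monomialBasis,
    Pi.basis_repr] at h
  change MvPolynomial.coeff e (MvPolynomial.monomial p.2 1 * F.diff k (Pi.single p.1 1) i) ≠ 0 at h
  rw [MvPolynomial.coeff_monomial_mul'] at h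
  split_ifs at h with hle
  · rw [one_mul] at h
    have := F.diff_homogeneous k p.1 i _ (MvPolynomial.mem_support_iff.2 h)
    rw [monomialDeg, monomialDeg, ← this, ← add_assoc, ← map_add, add_tsub_cancel_of_le hle]
  · exact absurd rfl h

lemma augK_mem (p : Σ _ : Fin (F.rank 0), Fin m →₀ ℕ) :
    F.augK (F.monomialBasis 0 p) ∈
      gradedPiece (AddMonoidAlgebra.basis (semigroup d) K) (fun s => (s : ℕ))
        (F.monomialDeg 0 p) := by
  rw [mem_gradedPiece]
  intro s h
  obtain ⟨t, ht, hp⟩ := paramHom_monomial K d p.2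
  rw [monomialBasis_apply] at h
  change (F.aug _).coeff s ≠ 0 at h
  rw [aug_smul, hp] at h
  by_cases hs : ∃ u, t + u = s
  · obtain ⟨u, rfl⟩ := hs
    rw [AddMonoidAlgebra.coeff_single_mul_eq_mul_coeff u (by simp), one_mul] at h
    have := F.aug_homogeneous p.1 u (Finsupp.mem_support_iff.2 h)
    rw [AddSubmonoid.coe_add, ht, this, monomialDeg]
  · exact absurd (AddMonoidAlgebra.coeff_single_mul_of_forall_add_ne _ _ fun u hu => hs ⟨u, hu⟩) h

lemma setOf_monomialDeg_eq (k j : ℕ) :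
    {p | F.monomialDeg k p = j} =
      ⋃ l, Sigma.mk l '' {e | Finsupp.weight d e + F.deg k l = j} := by
  ext ⟨l, e⟩
  simp [monomialDeg]

lemma finite_weight_add_eq (hd : IsMinimalBasis d) (i j : ℕ) :
    {e : Fin m →₀ ℕ | Finsupp.weight d e + i = j}.Finite :=
  (Finsupp.finite_of_nat_weight_le d hd.ne_zero j).subset fun e he => by
    simp only [Set.mem_ofPred_eq] at he ⊢
    omega

lemma finite_monomialDeg_eq (hd : IsMinimalBasis d) (k j : ℕ) :
    {p | F.monomialDeg k p = j}.Finite := by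
  rw [setOf_monomialDeg_eq]
  exact Set.finite_iUnion fun l => (finite_weight_add_eq hd _ _).image _

/-- The alternating sum of the dimensions of the degree `j` pieces of the resolution. -/
theorem sum_ncard_monomialDeg (hd : IsMinimalBasis d) (hm : 0 < m) (j : ℕ) :
    ∑ k ∈ Finset.range m, (-1 : ℤ) ^ k * ({p | F.monomialDeg k p = j}.ncard : ℤ) =
      ({s : semigroup d | (s : ℕ) = j}.ncard : ℤ) := by
  let ρ (k : ℕ) : ℤ := finrank K
    ((gradedPiece (F.monomialBasis (k + 1)) (F.monomialDeg (k + 1)) j).map (F.diffK k))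
  have hfin : {s : semigroup d | (s : ℕ) = j}.Finite :=
    (Set.finite_singleton j).preimage Subtype.val_injective.injOn
  -- By rank-nullity the alternating sum telescopes, leaving only the rank of the last incoming
  -- differential; for N = m - 1 its source is F_m = 0.
  have key : ∀ N, ∑ k ∈ Finset.range (N + 1),
      (-1 : ℤ) ^ k * ({p | F.monomialDeg k p = j}.ncard : ℤ) =
        {s : semigroup d | (s : ℕ) = j}.ncard + (-1) ^ N * ρ N := by
    intro N
    induction N with
    | zero =>
      have h := finrank_map_add_finrank_map  (f := F.diffK 0) (g := F.augK) (F.diffK_mem 0) F.exact_aug j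
        (F.finite_monomialDeg_eq hd 0 j)
      rw [map_gradedPiece F.augK_mem, (LinearMap.range_eq_top (f := F.augK)).2 F.aug_surjective, inf_top_eq,
        finrank_gradedPiece _ _ _ hfin] at h
      simp [← h, ρ]
    | succ N ih =>
      have h := finrank_map_add_finrank_map (f := F.diffK (N + 1)) (g := F.diffK N)
        (F.diffK_mem (N + 1)) (F.exact_diff N) j (F.finite_monomialDeg_eq hd (N + 1) j)
      rw [Finset.sum_range_succ, ih, ← h]
      simp only [ρ]
      push_cast
      ring
  obtain ⟨N, rfl⟩ : ∃ N, m = N + 1 := ⟨m - 1, by omega⟩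
  rw [key N]
  have h0 : ρ N = 0 := by
    have := F.rank_eq_zero hm le_rfl
    have : IsEmpty (Fin (F.rank (N + 1))) := by rw [this]; infer_instance
    simp only [ρ, Nat.cast_eq_zero]
    rw [Subsingleton.elim (gradedPiece _ _ _) ⊥, Submodule.map_bot, finrank_bot]
  rw [h0, mul_zero, add_zero]

lemma ncard_monomialDeg_eq (hd : IsMinimalBasis d) (k j : ℕ) :
    {p | F.monomialDeg k p = j}.ncard =
      ∑ l, if F.deg k l ≤ j then monomialCount d (j - F.deg k l) else 0 := by
  rw [setOf_monomialDeg_eq, Set.ncard_iUnion_of_finite, finsum_eq_sum_of_fintype]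
  · refine Finset.sum_congr rfl fun l _ => ?_
    rw [Set.ncard_image_of_injective _ sigma_mk_injective]
    split_ifs with hl
    · rw [monomialCount]
      congr 1
      ext e
      simp only [Set.mem_ofPred_eq]
      omega
    · rw [Set.ncard_eq_zero (finite_weight_add_eq hd _ _)]
      ext e
      simp only [Set.mem_ofPred_eq, Set.mem_empty_iff_false, iff_false]
      omega
  · exact fun l => (finite_weight_add_eq hd _ _).image _
  · intro l l' hl
    refine Set.disjoint_left.2 ?_
    rintro _ ⟨e, -, rfl⟩ ⟨e', -, h⟩
    exact hl (congrArg Sigma.fst h).symm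

/-- The `K`-polynomial `∑ (-1)^k β_{k,j} z^j` of the resolution. -/
noncomputable def kPolynomial : Polynomial ℂ :=
  ∑ k ∈ Finset.range m, (-1) ^ k * ∑ l, Polynomial.X ^ F.deg k l

theorem kPolynomial_mul_mk_monomialCount (hd : IsMinimalBasis d) (hm : 0 < m) :
    (F.kPolynomial : PowerSeries ℂ) * PowerSeries.mk (fun n => (monomialCount d n : ℂ)) =
      PowerSeries.mk fun n => ({s : semigroup d | (s : ℕ) = n}.ncard : ℂ) := by
  ext j
  rw [PowerSeries.coeff_mk, ← Int.cast_natCast, ← F.sum_ncard_monomialDeg hd hm j]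
  rw [kPolynomial, ← Polynomial.coeToPowerSeries.ringHom_apply, map_sum, Finset.sum_mul,
    map_sum, Int.cast_sum]
  refine Finset.sum_congr rfl fun k _ => ?_
  have h1 : ((-1 : PowerSeries ℂ)) ^ k = PowerSeries.C ((-1) ^ k) := by simp
  rw [map_mul Polynomial.coeToPowerSeries.ringHom, map_pow, map_neg, map_one, mul_assoc, h1,
    PowerSeries.coeff_C_mul, map_sum, Finset.sum_mul, map_sum, F.ncard_monomialDeg_eq hd]
  push_cast
  congr 1
  refine Finset.sum_congr rfl fun l _ => ?_
  rw [map_pow, Polynomial.coeToPowerSeries.ringHom_apply, Polynomial.coe_X,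
    PowerSeries.coeff_X_pow_mul', PowerSeries.coeff_mk]

end MinimalGradedResolution

/-! ### Vanishing order at a root of unity -/

open Polynomial

section EulerOperator

/-- The operator `z d/dz`. -/
noncomputable def eulerOp : ℂ[X] →ₗ[ℂ] ℂ[X] :=
  LinearMap.mulLeft ℂ X ∘ₗ derivative

lemma eulerOp_apply (P : ℂ[X]) : eulerOp P = X * derivative P := rfl

/-- Monomials are eigenvectors of z d/dz; this produces the weights j^r, including 0^0 = 1. -/
lemma eulerOp_pow_X_pow (r a : ℕ) : (eulerOp ^ r) (X ^ a) = (a : ℂ) ^ r • (X : ℂ[X]) ^ a := by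
  induction r with
  | zero => simp
  | succ r ih =>
    rw [pow_succ', Module.End.mul_apply, ih, map_smul, eulerOp_apply, derivative_X_pow, pow_succ,
      mul_smul]
    congr 1
    rcases a with _ | a
    · simp
    · rw [Nat.add_sub_cancel, ← mul_assoc, mul_comm X, mul_assoc, ← pow_succ', ← smul_eq_C_mul]

lemma pow_dvd_eulerOp {ζ : ℂ} {P : ℂ[X]} {w : ℕ} (h : (X - C ζ) ^ (w + 1) ∣ P) :
    (X - C ζ) ^ w ∣ eulerOp P := by
  obtain ⟨Q, rfl⟩ := h
  rw [eulerOp_apply, derivative_mul, derivative_X_sub_C_pow, Nat.add_sub_cancel]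
  refine Dvd.dvd.mul_left (dvd_add ?_ ?_) _
  · exact ((dvd_mul_left _ _)).mul_right _
  · exact (pow_dvd_pow _ (Nat.le_succ w)).mul_right _

lemma eval_eulerOp_pow_eq_zero {ζ : ℂ} {P : ℂ[X]} {w r : ℕ} (hr : r < w)
    (h : (X - C ζ) ^ w ∣ P) : ((eulerOp ^ r) P).eval ζ = 0 := by
  induction r generalizing P w with
  | zero =>
    obtain ⟨Q, rfl⟩ := (dvd_pow_self _ (by omega)).trans h
    simp
  | succ r ih =>
    obtain ⟨w, rfl⟩ : ∃ w', w = w' + 1 := ⟨w - 1, by omega⟩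
    rw [pow_succ, Module.End.mul_apply]
    exact ih (by omega) (pow_dvd_eulerOp h)

end EulerOperator

section RootMultiplicity

variable {ζ : ℂ} {q : ℕ}

lemma X_sub_C_dvd_one_sub_X_pow_iff (hζ : IsPrimitiveRoot ζ q) (a : ℕ) :
    X - C ζ ∣ (1 - X ^ a : ℂ[X]) ↔ q ∣ a := by
  rw [dvd_iff_isRoot, IsRoot, ← hζ.pow_eq_one_iff_dvd]
  rw [eval_sub, eval_one, eval_pow, eval_X, sub_eq_zero, eq_comm]

lemma X_sub_C_pow_dvd_prod {m : ℕ} (d : Fin m → ℕ) (hζ : IsPrimitiveRoot ζ q) :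
    (X - C ζ) ^ numDivisible d q ∣ ∏ i, (1 - X ^ d i : ℂ[X]) := by
  classical
  rw [numDivisible, ← Finset.prod_const]
  refine (Finset.prod_dvd_prod_of_dvd _ _ fun i hi => ?_).trans
    (Finset.prod_dvd_prod_of_subset _ _ _ (Finset.subset_univ _))
  exact (X_sub_C_dvd_one_sub_X_pow_iff hζ _).2 (Finset.mem_filter.1 hi).2

lemma not_X_sub_C_sq_dvd {g : ℕ} (hg : g ≠ 0) (hζ : ζ ≠ 0) :
    ¬ (X - C ζ) ^ (1 + 1) ∣ (1 - X ^ g : ℂ[X]) := fun h => by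
  -- A double root would also annihilate z d/dz (1 - z^g) = -g z^g, which is nonzero at ζ.
  have h1 := eval_eulerOp_pow_eq_zero (r := 1) (by norm_num) h
  rw [map_sub, ← pow_zero X, eulerOp_pow_X_pow, eulerOp_pow_X_pow] at h1
  simp [hg, hζ] at h1

end RootMultiplicity

section HilbertSeries

variable {m : ℕ} (d : Fin m → ℕ)

/-- The greatest common divisor of the generators. -/
noncomputable def genGcd : ℕ := Nat.setGcd (Set.range d)

lemma dvd_genGcd_iff {q : ℕ} : q ∣ genGcd d ↔ ∀ i, q ∣ d i := by
  rw [genGcd, Nat.dvd_setGcd_iff, Set.forall_mem_range]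

lemma genGcd_ne_zero (hm : 0 < m) (hd : IsMinimalBasis d) : genGcd d ≠ 0 := fun h =>
  hd.ne_zero ⟨0, hm⟩ (Nat.eq_zero_of_zero_dvd ((dvd_genGcd_iff d).1 (h ▸ dvd_rfl) ⟨0, hm⟩))

lemma ncard_coe_eq (n : ℕ) [Decidable (n ∈ semigroup d)] :
    {s : semigroup d | (s : ℕ) = n}.ncard = if n ∈ semigroup d then 1 else 0 := by
  split_ifs with h
  · rw [Set.ncard_eq_one]
    exact ⟨⟨n, h⟩, by ext s; simp [Subtype.ext_iff]⟩
  · have : {s : semigroup d | (s : ℕ) = n} = ∅ :=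
      Set.eq_empty_of_forall_notMem fun s hs => h (hs ▸ s.2)
    rw [this, Set.ncard_empty]

/-- The Hilbert series of `K[S]` is a polynomial divided by `1 - z ^ g`, where `g` is the greatest
common divisor of the generators. -/
lemma exists_hilbertSeries_mul_eq : ∃ Q : ℂ[X],
    (PowerSeries.mk fun n => ({s : semigroup d | (s : ℕ) = n}.ncard : ℂ)) *
      (1 - PowerSeries.X ^ genGcd d) = (Q : PowerSeries ℂ) := by
  classical
  obtain ⟨N, hN⟩ := Nat.exists_mem_closure_of_ge (Set.range d)
  have hS : ∀ n ∈ semigroup d, genGcd d ∣ n := fun n hn => Nat.setGcd_dvd_of_mem_closure hn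
  set P := (PowerSeries.mk fun n => ({s : semigroup d | (s : ℕ) = n}.ncard : ℂ)) *
      (1 - PowerSeries.X ^ genGcd d) with hP
  -- For n ≥ N + g both n and n - g are at least N, so each lies in S iff g divides it, and the
  -- coefficients cancel.
  refine ⟨PowerSeries.trunc (N + genGcd d) P, ?_⟩
  ext n
  rw [Polynomial.coeff_coe, PowerSeries.coeff_trunc]
  split_ifs with hn
  · rfl
  have hgn : genGcd d ≤ n := by omega
  rw [hP, mul_sub, mul_one, map_sub, PowerSeries.coeff_mul_X_pow', if_pos hgn,
    PowerSeries.coeff_mk, PowerSeries.coeff_mk, sub_eq_zero, ncard_coe_eq, ncard_coe_eq]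
  congr 2
  refine propext ⟨fun h => hN _ (by omega) ?_, fun h => hN _ (by omega) ?_⟩
  · exact Nat.dvd_sub (hS _ h) dvd_rfl
  · exact (Nat.dvd_sub_iff_left hgn dvd_rfl).1 (hS _ h)

end HilbertSeries

namespace MinimalGradedResolution

variable {K : Type*} [Field K] {m : ℕ} {d : Fin m → ℕ} (F : MinimalGradedResolution K d)

theorem prod_dvd_kPolynomial_mul (hd : IsMinimalBasis d) (hm : 0 < m) :
    ∏ i, (1 - X ^ d i : ℂ[X]) ∣ F.kPolynomial * (1 - X ^ genGcd d) := by
  obtain ⟨Q, hQ⟩ := exists_hilbertSeries_mul_eq d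
  refine ⟨Q, Polynomial.coe_injective ℂ ?_⟩
  have hprod : ((∏ i, (1 - X ^ d i : ℂ[X]) : ℂ[X]) : PowerSeries ℂ) =
      ∏ i, (1 - PowerSeries.X ^ d i) := by
    rw [← coeToPowerSeries.ringHom_apply, map_prod]
    simp
  rw [coe_mul, coe_mul, hprod, ← hQ, ← F.kPolynomial_mul_mk_monomialCount hd hm]
  have h1 := mk_monomialCount_mul hd.ne_zero
  rw [coe_sub, coe_one, coe_pow, coe_X]
  linear_combination (-(F.kPolynomial : PowerSeries ℂ) * (1 - PowerSeries.X ^ genGcd d)) * h1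

/-- The vanishing order of the `K`-polynomial at a primitive `q`-th root of unity. -/
theorem pow_dvd_kPolynomial (hd : IsMinimalBasis d) (hm : 0 < m) {ζ : ℂ} {q : ℕ}
    (hζ : IsPrimitiveRoot ζ q) (hq : q ≠ 0) :
    (X - C ζ) ^ (if ∀ i, q ∣ d i then m - 1 else numDivisible d q) ∣ F.kPolynomial := by
  have h := (X_sub_C_pow_dvd_prod d hζ).trans (F.prod_dvd_kPolynomial_mul hd hm)
  have hp := prime_X_sub_C ζ
  split_ifs with hall
  · obtain ⟨u, hu⟩ := (X_sub_C_dvd_one_sub_X_pow_iff hζ _).2 ((dvd_genGcd_iff d).2 hall)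
    have hw : numDivisible d q = m - 1 + 1 := by
      rw [numDivisible, Finset.filter_true_of_mem fun i _ => hall i, Finset.card_fin]
      omega
    -- One factor X - ζ is absorbed by 1 - X^g = (X - ζ) u; simplicity of the root gives u(ζ) ≠ 0.
    rw [hw, hu, mul_left_comm, pow_succ', mul_dvd_mul_iff_left hp.ne_zero] at h
    refine hp.pow_dvd_of_dvd_mul_right _ (fun hdvd => ?_) h
    refine not_X_sub_C_sq_dvd (genGcd_ne_zero d hm hd) (hζ.ne_zero hq) (ζ := ζ) ?_
    rw [hu, pow_succ, pow_one]
    exact mul_dvd_mul_left _ hdvd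
  · refine hp.pow_dvd_of_dvd_mul_right _ ?_ h
    rwa [X_sub_C_dvd_one_sub_X_pow_iff hζ, dvd_genGcd_iff]

lemma eval_eulerOp_pow_kPolynomial (ζ : ℂ) (r : ℕ) :
    ((eulerOp ^ r) F.kPolynomial).eval ζ =
      ∑ k ∈ Finset.range m, ∑ j ∈ F.shifts k,
        (-1 : ℂ) ^ k * (F.betti k j : ℂ) * (j : ℂ) ^ r * ζ ^ j := by
  rw [kPolynomial, map_sum, eval_finsetSum]
  refine Finset.sum_congr rfl fun k _ => ?_
  have h1 : ((-1 : ℂ[X])) ^ k = C ((-1) ^ k) := by simp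
  rw [h1, ← smul_eq_C_mul, map_smul, map_sum, eval_smul, eval_finsetSum, shifts,
    Finset.smul_sum]
  simp only [eulerOp_pow_X_pow, eval_smul, eval_pow, eval_X, smul_eq_mul]
  -- Grouping basis elements by degree makes the Betti numbers appear as fibre sizes.
  rw [Finset.sum_comp (fun j : ℕ => (-1 : ℂ) ^ k * ((j : ℂ) ^ r * ζ ^ j)) (F.deg k)]
  refine Finset.sum_congr rfl fun j _ => ?_
  rw [betti, nsmul_eq_mul]
  ring

end MinimalGradedResolution

end NumSgp

theorem theorem2p3 (K : Type*) [Field K] (m : ℕ) (hm : 0 < m) (d : Fin m → ℕ)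
    (hd : NumSgp.IsMinimalBasis d) (F : NumSgp.MinimalGradedResolution K d)
    (q : ℕ) (n : ℤ) (hq : 1 ≤ q) (hqd : q ≤ d ⟨m - 1, Nat.sub_lt hm Nat.one_pos⟩)
    (hnq : Int.gcd n q = 1) (hw : 0 < NumSgp.numDivisible d q)
    (r : ℕ) (hr : r ≤ NumSgp.numDivisible d q - 1)
    (hexc : ¬ ((∀ i, q ∣ d i) ∧ r = m - 1)) :
    ∑ k ∈ Finset.range m, ∑ j ∈ F.shifts k,
      (-1 : ℂ) ^ k * (F.betti k j : ℂ) * (j : ℂ) ^ r *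
        Complex.exp (Complex.I * (2 * (Real.pi : ℂ) * (n : ℂ) / (q : ℂ)) * (j : ℂ)) = 0 := by
  have hζ := (Complex.isPrimitiveRoot_exp q (by omega)).zpow_of_gcd_eq_one n hnq
  have hexp : ∀ j : ℕ,
      Complex.exp (Complex.I * (2 * (Real.pi : ℂ) * (n : ℂ) / (q : ℂ)) * (j : ℂ)) =
        (Complex.exp (2 * Real.pi * Complex.I / q) ^ n) ^ j := fun j => by
    rw [← Complex.exp_int_mul, ← Complex.exp_nat_mul]
    congr 1
    ring
  simp only [hexp]
  rw [← F.eval_eulerOp_pow_kPolynomial]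
  refine NumSgp.eval_eulerOp_pow_eq_zero ?_ (F.pow_dvd_kPolynomial hd hm hζ (by omega))
  have hle : NumSgp.numDivisible d q ≤ m := (Finset.card_filter_le _ _).trans_eq (by simp)
  split_ifs with hall
  -- Here r ≤ w_q - 1 ≤ m - 1, and the excluded value is exactly the one lost to the pole of H.
  · have : r ≠ m - 1 := fun h => hexc ⟨hall, h⟩
    omega
  · omega
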